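/- For integers $n, d \ge 1$ and $\rho\in[-1,1]$, $\rho\neq 0$, consider testing, from a pair of databases $X^n=(X_1,\dots,X_n)$ and $Y^n=(Y_1,\dots,Y_n)$ of vectors in $\mathbb{R}^d$, the hypotheses - $H_0$: $X_1,\dots,X_n,Y_1,\dots,Y_n$ are i.i.d. $\mathcal N(0,\mathbf I_d)$ (law $\mathbb P_0$); - $H_1$: for some unknown permutation $\sigma$ of $\{1,\dots,n\}$, the pairs $(X_1,Y_{\sigma_1}),\dots,(X_n,Y_{\sigma_n})$ are i.i.d. with law $\mathcal N^{\otimes d}\Big(\begin{bmatrix}0\\0\end{bmatrix},\begin{bmatrix}1&\rho\\ \rho&1\end{bmatrix}\Big)$, i.e. the $d$ pairs of coordinates are i.i.d. centred bivariate normal with unit variances and correlation $\rho$ (law $\mathbb P_{1|\sigma}$). Let $$R^*=\inf_{\phi}\Big(\mathbb P_0\{\phi(X^n,Y^n)=1\}+\max_{\sigma\in S_n}\mathbb P_{1|\sigma}\{\phi(X^n,Y^n)=0\}\Big),$$ where the infimum is over all measurable tests $\phi:\mathbb R^{d\times n}\times\mathbb R^{d\times n}\to\{0,1\}$, be the minimax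 risk. **Theorem (Detection converse).** Let $n\ge e^2$. If $n, d\to\infty$ and $\rho$ varies with them, along any sequence (or, more generally, any filter), in such a way that $$\rho^2=o\Big(\frac1{d\sqrt n}\Big)\quad\text{and}\quad d=\Omega(\ln n),$$ then $R^*\to1$. -/

import Mathlib

open MeasureTheory ProbabilityTheory Filter Asymptotics

noncomputable section

namespace DatabaseAlignment

/-- A database with `n` users and `d` features: `n` vectors `X₁, …, Xₙ` of `ℝᵈ`. -/
abbrev Database (n d : ℕ) : Type := Fin n → Fin d → ℝ

/-- The standard normal law `𝒩(0, I_d)` on `ℝᵈ`. -/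
def stdNormal (d : ℕ) : Measure (Fin d → ℝ) :=
  Measure.pi fun _ => gaussianReal 0 1

/-- The joint law `P_XY = 𝒩^{⊗d}((0, 0), [1 ρ; ρ 1])` of a pair of vectors of `ℝᵈ`:
the `d` pairs of coordinates are i.i.d. centred bivariate normal, with unit variances and
correlation `ρ`. -/
def correlatedPair (d : ℕ) (ρ : ℝ) : Measure ((Fin d → ℝ) × (Fin d → ℝ)) :=
  (Measure.pi fun _ : Fin d =>
      multivariateGaussian (0 : EuclideanSpace ℝ (Fin 2)) !![1, ρ; ρ, 1]).map
    fun z => (fun j => z j 0, fun j => z j 1)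

/-- The law of `(Xⁿ, Yⁿ)` under the null hypothesis: all of `X₁, …, Xₙ, Y₁, …, Yₙ` are i.i.d.
standard normal vectors. -/
def nullLaw (n d : ℕ) : Measure (Database n d × Database n d) :=
  (Measure.pi fun _ => stdNormal d).prod (Measure.pi fun _ => stdNormal d)

/-- The law of `(Xⁿ, Yⁿ)` under the alternative with permutation `σ`: the pairs
`(Xᵢ, Y_{σ i})` are i.i.d. with law `P_XY`. From i.i.d. pairs `wᵢ` one sets
`Xᵢ = (wᵢ).1` and `Y_{σ i} = (wᵢ).2`. -/
def altLaw (n d : ℕ) (ρ : ℝ) (σ : Equiv.Perm (Fin n)) :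
    Measure (Database n d × Database n d) :=
  (Measure.pi fun _ : Fin n => correlatedPair d ρ).map
    fun w => (fun i => (w i).1, fun j => (w (σ.symm j)).2)

/-- The risk of a test: the probability of false alarm plus the worst-case probability, over
the permutations, of missed detection. -/
def risk (n d : ℕ) (ρ : ℝ) (φ : Database n d × Database n d → Fin 2) : ℝ :=
  (nullLaw n d).real {p | φ p = 1} +
    ⨆ σ : Equiv.Perm (Fin n), (altLaw n d ρ σ).real {p | φ p = 0}

/-- The minimax risk: the infimum of the risk over all measurable tests. -/
def minimaxRisk (n d : ℕ) (ρ : ℝ) : ℝ :=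
  ⨅ φ : {φ : Database n d × Database n d → Fin 2 // Measurable φ}, risk n d ρ φ.1

end DatabaseAlignment

end

/-!
The proof bounds the minimax risk from below by the Bayes risk for a uniformly random permutation
and controls the latter through the second moment of the likelihood ratio (`one_sub_le_add_iSup`):
if the uniform mixture of the alternatives has density `L` with respect to the null law and
`E₀[L²] ≤ 1 + o(1)`, every test has risk at least `1 - o(1)`. A constant test has risk `1`.

For `|ρ| < 1` the pair `(x, y)` of correlated standard normal variables has density the Mehler
kernel `k_ρ(x, y)` with respect to the product of its marginals (`map_multivariateGaussian`), so the
alternative with permutation `σ` has density `∏ i, K_ρ(X i, Y (σ i))`, where `K_ρ` is the `d`-fold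
product of `k_ρ` (`altLaw_eq_withDensity`). Two properties of the kernel are needed: the semigroup
law `∫ K_r(x, y) K_s(y, z) dγ(y) = K_{rs}(x, z)` and the trace `∫ K_r(y, y) dγ(y) = (1 - r)⁻ᵈ`.

Integrating out `X`, the mixed moment of the densities for `σ` and `τ` becomes
`E ∏ i, K_{ρ²}(Y i, Y (π i))` with `π = τ σ⁻¹`. The variables `Y i` are then integrated out one at a
time (`lintegral_prod_kernel_le`): at a fixed point of the current permutation this costs a factor
at most `t = (1 - ρ²)⁻ᵈ`, and otherwise two edges merge into one, with the product of their
parameters, which stays in `[0, ρ²]`. Hence the moment is at most `t` to the number of cycles of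
`π`, and the sum of these bounds over all `π` is the rising factorial `t (t + 1) ⋯ (t + n - 1)`.
Dividing by `n!`,
`E₀[L²] ≤ ∏_{j ≤ n} (1 + (t - 1) / j) ≤ exp ((t - 1) Hₙ) ≤ exp (4 d ρ² √n)`,
since `t - 1 ≤ 2 d ρ²` once `d ρ² ≤ 1 / 2`, and the harmonic number `Hₙ` is at most `2 √n`.
-/

namespace DatabaseAlignment

open scoped ENNReal

/-! ### Integrals and densities on finite products -/

theorem lintegral_pi_succ {α : Type*} [MeasurableSpace α] (μ : Measure α) [SigmaFinite μ] {n : ℕ}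
    {f : (Fin (n + 1) → α) → ℝ≥0∞} (hf : Measurable f) :
    ∫⁻ y, f y ∂(Measure.pi fun _ => μ) =
      ∫⁻ y, ∫⁻ a, f (Fin.cons a y) ∂μ ∂(Measure.pi fun _ : Fin n => μ) := by
  rw [← ((measurePreserving_piFinSuccAbove (fun _ : Fin (n + 1) => μ) 0).symm).lintegral_comp hf,
    lintegral_prod_symm]
  · simp only [MeasurableEquiv.piFinSuccAbove_symm_apply, Fin.insertNthEquiv, Equiv.coe_fn_mk,
      Fin.insertNth_zero']
  · exact (hf.comp (MeasurableEquiv.measurable _)).aemeasurable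

theorem lintegral_pi_prod {α : Type*} [MeasurableSpace α] (μ : Measure α) [SigmaFinite μ] {n : ℕ}
    {f : Fin n → α → ℝ≥0∞} (hf : ∀ i, Measurable (f i)) :
    ∫⁻ y, ∏ i, f i (y i) ∂(Measure.pi fun _ => μ) = ∏ i, ∫⁻ a, f i a ∂μ := by
  induction n with
  | zero => simp
  | succ n ih =>
    rw [lintegral_pi_succ μ (by fun_prop)]
    simp only [Fin.prod_univ_succ, Fin.cons_zero, Fin.cons_succ]
    simp_rw [lintegral_mul_const _ (hf 0)]
    rw [lintegral_const_mul _ (by fun_prop), ih fun i => hf i.succ]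

theorem pi_withDensity {α : Type*} [MeasurableSpace α] (μ : Measure α) [SigmaFinite μ] {n : ℕ}
    {f : α → ℝ≥0∞} (hf : Measurable f) [SigmaFinite (μ.withDensity f)] :
    (Measure.pi fun _ : Fin n => μ.withDensity f) =
      (Measure.pi fun _ : Fin n => μ).withDensity fun x => ∏ i, f (x i) := by
  refine (Measure.pi_eq fun s hs => ?_)
  rw [withDensity_apply _ (.univ_pi hs), ← lintegral_indicator (.univ_pi hs)]
  have h : ∀ x : Fin n → α, (Set.univ.pi s).indicator (fun x => ∏ i, f (x i)) x =
      ∏ i, (s i).indicator f (x i) := by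
    intro x
    by_cases hx : x ∈ Set.univ.pi s
    · rw [Set.indicator_of_mem hx]
      exact Finset.prod_congr rfl fun i _ => (Set.indicator_of_mem (hx i trivial) f).symm
    · rw [Set.indicator_of_notMem hx]
      simp only [Set.mem_pi, Set.mem_univ, true_implies, not_forall] at hx
      obtain ⟨i, hi⟩ := hx
      exact (Finset.prod_eq_zero (Finset.mem_univ i) (Set.indicator_of_notMem hi f)).symm
  simp_rw [h]
  rw [lintegral_pi_prod μ fun i => hf.indicator (hs i)]
  exact Finset.prod_congr rfl fun i _ => by
    rw [lintegral_indicator (hs i), withDensity_apply _ (hs i)]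

/-- A density which factors through `g` passes to the image measure under `g`. -/
theorem map_withDensity_comp {α β : Type*} [MeasurableSpace α] [MeasurableSpace β] {μ : Measure α}
    {g : α → β} (hg : Measurable g) {f : β → ℝ≥0∞} (hf : Measurable f) :
    (μ.withDensity (f ∘ g)).map g = (μ.map g).withDensity f := by
  ext s hs
  rw [Measure.map_apply hg hs, withDensity_apply _ (hg hs), withDensity_apply _ hs,
    setLIntegral_map hs hf hg]
  rfl

/-- If i.i.d. pairs with density `k` are regrouped into the family of first and the family of second
components, the resulting density is the product of the values of `k`. -/
theorem map_pi_prod_withDensity {α β : Type*} [MeasurableSpace α] [MeasurableSpace β]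
    (μ : Measure α) (ν : Measure β) [SigmaFinite μ] [SigmaFinite ν] {n : ℕ}
    {k : α × β → ℝ≥0∞} (hk : Measurable k) [SigmaFinite ((μ.prod ν).withDensity k)] :
    (Measure.pi fun _ : Fin n => (μ.prod ν).withDensity k).map
        (fun w => (fun i => (w i).1, fun i => (w i).2)) =
      ((Measure.pi fun _ : Fin n => μ).prod (Measure.pi fun _ : Fin n => ν)).withDensity
        fun p => ∏ i, k (p.1 i, p.2 i) := by
  rw [pi_withDensity _ hk]
  have h := (measurePreserving_arrowProdEquivProdArrow α β (Fin n) (fun _ => μ) (fun _ => ν)).map_eq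
  rw [← h, ← map_withDensity_comp (MeasurableEquiv.measurable _) (by fun_prop)]
  rfl

/-! ### Second moment lower bound for the risk -/

/-- **Le Cam's bound by the second moment method.** If the laws `Q i` have densities `L i` with
respect to `P`, and the average of the `L i` has second moment at most `M`, then the type I error
plus the worst type II error of any test is at least `1 - (a ^ 2 + M - 1) / (2 * a)`. The choice
`a = √(M - 1)` is optimal; leaving `a` free avoids the square root and the case `M = 1`. -/
theorem one_sub_le_add_iSup {Ω ι : Type*} [MeasurableSpace Ω] [Fintype ι] [Nonempty ι]
    {P : Measure Ω} [IsProbabilityMeasure P] {Q : ι → Measure Ω} [∀ i, IsProbabilityMeasure (Q i)]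
    {L : ι → Ω → ℝ≥0∞} (hL : ∀ i, Measurable (L i)) (hQ : ∀ i, Q i = P.withDensity (L i))
    {M : ℝ} (hM : 0 ≤ M)
    (h2 : ∑ i, ∑ j, ∫⁻ ω, L i ω * L j ω ∂P ≤ ENNReal.ofReal ((Fintype.card ι : ℝ) ^ 2 * M))
    {a : ℝ} (ha : 0 < a) {A : Set Ω} (hA : MeasurableSet A) :
    1 - (a ^ 2 + M - 1) / (2 * a) ≤ P.real A + ⨆ i, (Q i).real Aᶜ := by
  set N : ℝ := (Fintype.card ι : ℝ) with hN
  have hN0 : 0 < N := by rw [hN]; exact_mod_cast Fintype.card_pos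
  set S : Ω → ℝ≥0∞ := fun ω => ∑ i, L i ω with hS
  have hSm : Measurable S := by fun_prop
  have hSi : ∀ B, MeasurableSet B → ∫⁻ ω in B, S ω ∂P = ∑ i, Q i B := by
    intro B hB
    rw [lintegral_finsetSum _ fun i _ => hL i]
    exact Finset.sum_congr rfl fun i _ => by rw [hQ i, withDensity_apply _ hB]
  have hS2 : ∫⁻ ω, S ω ^ 2 ∂P ≤ ENNReal.ofReal (N ^ 2 * M) := by
    refine le_trans (le_of_eq ?_) h2
    simp_rw [hS, sq, Finset.sum_mul_sum]
    rw [lintegral_finsetSum _ fun i _ => by fun_prop]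
    exact Finset.sum_congr rfl fun i _ => by rw [lintegral_finsetSum _ fun j _ => by fun_prop]
  have hS2top : ∫⁻ ω, S ω ^ 2 ∂P ≠ ∞ := (hS2.trans_lt ENNReal.ofReal_lt_top).ne
  have hStop : ∀ᵐ ω ∂P, S ω ≠ ∞ := by
    filter_upwards [ae_lt_top (hSm.pow_const 2) hS2top] with ω h h'
    simp [h'] at h
  have hint : Integrable (fun ω => (S ω).toReal) P := by
    refine integrable_toReal_of_lintegral_ne_top hSm.aemeasurable ?_
    rw [← setLIntegral_univ, hSi _ .univ]
    simp
  have hint2 : Integrable (fun ω => (S ω).toReal ^ 2) P := by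
    simp_rw [← ENNReal.toReal_pow]
    exact integrable_toReal_of_lintegral_ne_top (by fun_prop) hS2top
  have hI : ∀ B, MeasurableSet B → ∫ ω in B, (S ω).toReal ∂P = ∑ i, (Q i).real B := by
    intro B hB
    rw [integral_toReal hSm.aemeasurable (ae_restrict_of_ae
      (hStop.mono fun ω h => lt_top_iff_ne_top.2 h)), hSi B hB,
      ENNReal.toReal_sum fun i _ => measure_ne_top _ _]
    rfl
  have hI1 : ∫ ω, (S ω).toReal ∂P = N := by
    rw [← setIntegral_univ, hI _ .univ]
    simp [hN]
  have hI2 : ∫ ω, (S ω).toReal ^ 2 ∂P ≤ N ^ 2 * M := by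
    simp_rw [← ENNReal.toReal_pow]
    rw [integral_toReal (by fun_prop) (hStop.mono fun ω h =>
      lt_top_iff_ne_top.2 (ENNReal.pow_ne_top h))]
    exact ENNReal.toReal_le_of_le_ofReal (by positivity) hS2
  have hsum : ∑ i, (Q i).real Aᶜ ≤ N * ⨆ i, (Q i).real Aᶜ := by
    refine (Finset.sum_le_card_nsmul _ _ (⨆ i, (Q i).real Aᶜ) fun i _ =>
      le_ciSup (f := fun i => (Q i).real Aᶜ) (Set.finite_range _).bddAbove i).trans ?_
    simp [hN]
  have hexp : (fun ω => (N - (S ω).toReal) ^ 2) =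
      fun ω => N ^ 2 - 2 * N * (S ω).toReal + (S ω).toReal ^ 2 := by ext; ring
  have hlin : ∀ b c : ℝ, Integrable (fun ω => b - c * (S ω).toReal) P :=
    fun b c => (integrable_const b).sub (hint.const_mul c)
  have hi : Integrable (fun ω => (N - (S ω).toReal) ^ 2) P := by
    rw [hexp]
    exact (hlin _ _).add hint2
  -- The pointwise inequality `1 - s ≤ a / 2 + (1 - s) ^ 2 / (2 * a)` at `s = S / N`,
  -- multiplied by `2 * a * N ^ 2`, is integrated over `Aᶜ`.
  have key : ∫ ω in Aᶜ, (2 * a * N ^ 2 - a ^ 2 * N ^ 2 - 2 * a * N * (S ω).toReal) ∂P ≤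
      ∫ ω, (N - (S ω).toReal) ^ 2 ∂P := by
    refine le_trans ?_ (setIntegral_le_integral (s := Aᶜ) hi (ae_of_all _ fun _ => sq_nonneg _))
    refine integral_mono (hlin _ _).integrableOn hi.integrableOn fun ω => ?_
    nlinarith [sq_nonneg (N - (S ω).toReal - a * N)]
  have e1 : ∫ ω, (N - (S ω).toReal) ^ 2 ∂P ≤ N ^ 2 * (M - 1) := by
    rw [hexp, integral_add (hlin _ _) hint2, integral_sub (integrable_const _) (hint.const_mul _),
      integral_const_mul, hI1]
    simp only [integral_const, probReal_univ, one_smul]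
    nlinarith
  have e2 : ∫ ω in Aᶜ, (2 * a * N ^ 2 - a ^ 2 * N ^ 2 - 2 * a * N * (S ω).toReal) ∂P =
      (2 * a * N ^ 2 - a ^ 2 * N ^ 2) * (1 - P.real A) - 2 * a * N * ∑ i, (Q i).real Aᶜ := by
    rw [← hI _ hA.compl, ← probReal_compl_eq_one_sub hA,
      integral_sub (integrable_const _) (hint.const_mul _).integrableOn,
      integral_const_mul (2 * a * N) fun ω => (S ω).toReal]
    simp [mul_comm]
  rw [e2] at key
  have hPA : 0 ≤ P.real A := measureReal_nonneg
  set T := ⨆ i, (Q i).real Aᶜ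
  have h3 : 2 * a * (1 - P.real A - T) ≤ a ^ 2 + M - 1 := by
    have h4 : N ^ 2 * (2 * a * (1 - P.real A - T)) ≤ N ^ 2 * (a ^ 2 + M - 1) := by
      have := mul_le_mul_of_nonneg_left hsum (show 0 ≤ 2 * a * N by positivity)
      have h5 : 0 ≤ a ^ 2 * N ^ 2 * P.real A := by positivity
      nlinarith
    exact le_of_mul_le_mul_left h4 (by positivity)
  have h6 : 1 - P.real A - T ≤ (a ^ 2 + M - 1) / (2 * a) := by
    rw [le_div_iff₀ (by positivity)]
    linarith
  linarith

/-! ### The Mehler kernel -/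

/-- The Mehler kernel: for `|r| < 1`, the density at `(x, y)` of the centred bivariate normal law
with unit variances and correlation `r`, with respect to the product of two standard normal
laws. -/
noncomputable def mehlerReal (r x y : ℝ) : ℝ :=
  (√(1 - r ^ 2))⁻¹ *
    Real.exp (-(r ^ 2 * x ^ 2 + r ^ 2 * y ^ 2 - 2 * r * x * y) / (2 * (1 - r ^ 2)))

theorem mehlerReal_nonneg (r x y : ℝ) : 0 ≤ mehlerReal r x y := by
  unfold mehlerReal; positivity

/-- As a function of `y`, the Mehler kernel is the density of `𝒩(r x, 1 - r²)` with respect to the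
standard normal law. -/
theorem mehlerReal_mul_pdf {r : ℝ} (hr : |r| < 1) (x y : ℝ) :
    mehlerReal r x y * gaussianPDFReal 0 1 y =
      gaussianPDFReal (r * x) (1 - r ^ 2).toNNReal y := by
  have h : 0 < 1 - r ^ 2 := by
    have := (sq_lt_one_iff_abs_lt_one r).2 hr; linarith
  rw [mehlerReal, gaussianPDFReal, gaussianPDFReal, Real.coe_toNNReal _ h.le,
    mul_mul_mul_comm, ← Real.exp_add, ← mul_inv, ← Real.sqrt_mul h.le]
  congr 3
  · push_cast; ring
  · push_cast; field_simp; ring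

/-- Completing the square in `y`: the integrand of the semigroup law is a multiple of a normal
density. -/
theorem mehlerReal_mul_mehlerReal_mul_pdf {r s : ℝ} (hr : |r| < 1) (hs : |s| < 1) (x y z : ℝ) :
    mehlerReal r x y * mehlerReal s y z * gaussianPDFReal 0 1 y =
      mehlerReal (r * s) x z *
        gaussianPDFReal ((r * x * (1 - s ^ 2) + s * z * (1 - r ^ 2)) / (1 - (r * s) ^ 2))
          ((1 - r ^ 2) * (1 - s ^ 2) / (1 - (r * s) ^ 2)).toNNReal y := by
  have h1 : 0 < 1 - r ^ 2 := by
    have := (sq_lt_one_iff_abs_lt_one r).2 hr; linarith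
  have h2 : 0 < 1 - s ^ 2 := by
    have := (sq_lt_one_iff_abs_lt_one s).2 hs; linarith
  have h3 : 0 < 1 - (r * s) ^ 2 := by nlinarith [sq_nonneg r, sq_nonneg s, mul_pow r s 2]
  have h4 : 0 < (1 - r ^ 2) * (1 - s ^ 2) / (1 - (r * s) ^ 2) := by positivity
  have e1 : mehlerReal r x y * mehlerReal s y z * gaussianPDFReal 0 1 y =
      ((√(1 - r ^ 2))⁻¹ * (√(1 - s ^ 2))⁻¹ * (√(2 * Real.pi * 1))⁻¹) *
      Real.exp (-(r ^ 2 * x ^ 2 + r ^ 2 * y ^ 2 - 2 * r * x * y) / (2 * (1 - r ^ 2)) +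
        -(s ^ 2 * y ^ 2 + s ^ 2 * z ^ 2 - 2 * s * y * z) / (2 * (1 - s ^ 2)) +
        -(y - 0) ^ 2 / (2 * 1)) := by
    rw [mehlerReal, mehlerReal, gaussianPDFReal, Real.exp_add, Real.exp_add]
    push_cast
    ring
  rw [e1, mehlerReal, gaussianPDFReal, Real.coe_toNNReal _ h4.le, mul_mul_mul_comm (√(1 - _))⁻¹,
    ← Real.exp_add, ← mul_inv, ← mul_inv, ← mul_inv, ← Real.sqrt_mul h1.le,
    ← Real.sqrt_mul (by positivity), ← Real.sqrt_mul h3.le]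
  rw [mul_pow] at h3 ⊢
  have h5 := h3.ne'
  congr 1
  · congr 2
    field_simp
  · congr 1
    field_simp
    ring

theorem mehlerReal_diag_mul_pdf {r : ℝ} (hr : |r| < 1) (y : ℝ) :
    mehlerReal r y y * gaussianPDFReal 0 1 y =
      (1 - r)⁻¹ * gaussianPDFReal 0 ((1 + r) / (1 - r)).toNNReal y := by
  have h1 : 0 < 1 - r := by linarith [(abs_lt.1 hr).2]
  have h2 : 0 < 1 + r := by linarith [(abs_lt.1 hr).1]
  have h : 1 - r ^ 2 = (1 - r) * (1 + r) := by ring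
  have h4 : 0 < (1 + r) / (1 - r) := by positivity
  rw [mehlerReal, gaussianPDFReal, gaussianPDFReal, Real.coe_toNNReal _ h4.le, h,
    mul_mul_mul_comm, ← Real.exp_add, ← mul_inv, ← Real.sqrt_mul (by positivity),
    ← mul_assoc (1 - r)⁻¹, ← mul_inv (1 - r)]
  congr 1
  · congr 1
    rw [show (1 - r) * √(2 * Real.pi * ((1 + r) / (1 - r))) =
      √((1 - r) ^ 2 * (2 * Real.pi * ((1 + r) / (1 - r)))) by
        rw [Real.sqrt_mul (sq_nonneg _), Real.sqrt_sq h1.le]]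
    congr 1
    push_cast
    field_simp
  · congr 1
    push_cast
    field_simp
    ring

theorem mehlerReal_comm (r x y : ℝ) : mehlerReal r x y = mehlerReal r y x := by
  unfold mehlerReal
  ring_nf

/-- The Mehler kernel with values in `ℝ≥0∞`, as used for densities. -/
noncomputable def mehler (r : ℝ) (x y : ℝ) : ℝ≥0∞ := ENNReal.ofReal (mehlerReal r x y)

@[fun_prop]
theorem measurable_mehler {α : Type*} [MeasurableSpace α] (r : ℝ) {f g : α → ℝ}
    (hf : Measurable f) (hg : Measurable g) : Measurable fun a => mehler r (f a) (g a) := by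
  unfold mehler mehlerReal
  fun_prop

theorem mehler_comm (r x y : ℝ) : mehler r x y = mehler r y x := by
  rw [mehler, mehlerReal_comm, mehler]

theorem lintegral_stdGaussian {f : ℝ → ℝ≥0∞} (hf : Measurable f) :
    ∫⁻ y, f y ∂(gaussianReal 0 1) = ∫⁻ y, f y * gaussianPDF 0 1 y := by
  rw [gaussianReal_of_var_ne_zero _ one_ne_zero,
    lintegral_withDensity_eq_lintegral_mul _ (measurable_gaussianPDF 0 1) hf]
  exact lintegral_congr fun y => mul_comm _ _

theorem lintegral_mehler_mul {r : ℝ} (hr : |r| < 1) (x : ℝ) {f : ℝ → ℝ≥0∞} (hf : Measurable f) :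
    ∫⁻ y, mehler r x y * f y ∂(gaussianReal 0 1) =
      ∫⁻ y, f y ∂(gaussianReal (r * x) (1 - r ^ 2).toNNReal) := by
  have hv : (1 - r ^ 2).toNNReal ≠ 0 := by
    have := (sq_lt_one_iff_abs_lt_one r).2 hr
    simpa using this
  rw [lintegral_stdGaussian (by fun_prop), gaussianReal_of_var_ne_zero _ hv,
    lintegral_withDensity_eq_lintegral_mul _ (measurable_gaussianPDF _ _) hf]
  refine lintegral_congr fun y => ?_
  rw [Pi.mul_apply, gaussianPDF, gaussianPDF, ← mehlerReal_mul_pdf hr,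
    ENNReal.ofReal_mul (mehlerReal_nonneg _ _ _), mehler]
  ring

/-- The semigroup law of the Mehler kernels. -/
theorem lintegral_mehler_mul_mehler {r s : ℝ} (hr : |r| < 1) (hs : |s| < 1) (x z : ℝ) :
    ∫⁻ y, mehler r x y * mehler s y z ∂(gaussianReal 0 1) = mehler (r * s) x z := by
  have h1 : 0 < 1 - r ^ 2 := by
    have := (sq_lt_one_iff_abs_lt_one r).2 hr; linarith
  have h2 : 0 < 1 - s ^ 2 := by
    have := (sq_lt_one_iff_abs_lt_one s).2 hs; linarith
  have h3 : 0 < 1 - (r * s) ^ 2 := by nlinarith [sq_nonneg r, sq_nonneg s, mul_pow r s 2]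
  have h4 : 0 < (1 - r ^ 2) * (1 - s ^ 2) / (1 - (r * s) ^ 2) := by positivity
  rw [lintegral_stdGaussian (by fun_prop)]
  have h : ∀ y, mehler r x y * mehler s y z * gaussianPDF 0 1 y = mehler (r * s) x z *
      gaussianPDF ((r * x * (1 - s ^ 2) + s * z * (1 - r ^ 2)) / (1 - (r * s) ^ 2))
          ((1 - r ^ 2) * (1 - s ^ 2) / (1 - (r * s) ^ 2)).toNNReal y := by
    intro y
    simp only [mehler, gaussianPDF]
    rw [← ENNReal.ofReal_mul (mehlerReal_nonneg _ _ _), ← ENNReal.ofReal_mul (by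
      have := mehlerReal_nonneg r x y; have := mehlerReal_nonneg s y z; positivity),
      ← ENNReal.ofReal_mul (mehlerReal_nonneg _ _ _), mehlerReal_mul_mehlerReal_mul_pdf hr hs]
  simp_rw [h]
  rw [lintegral_const_mul _ (measurable_gaussianPDF _ _),
    lintegral_gaussianPDF_eq_one _ (by simpa using h4), mul_one]

/-- The trace of the Mehler kernel. -/
theorem lintegral_mehler_diag {r : ℝ} (hr : |r| < 1) :
    ∫⁻ y, mehler r y y ∂(gaussianReal 0 1) = ENNReal.ofReal (1 - r)⁻¹ := by
  have h1 : 0 < 1 - r := by linarith [(abs_lt.1 hr).2]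
  have h2 : 0 < 1 + r := by linarith [(abs_lt.1 hr).1]
  have h4 : 0 < (1 + r) / (1 - r) := by positivity
  rw [lintegral_stdGaussian (by fun_prop)]
  have h : ∀ y, mehler r y y * gaussianPDF 0 1 y =
      ENNReal.ofReal (1 - r)⁻¹ * gaussianPDF 0 ((1 + r) / (1 - r)).toNNReal y := by
    intro y
    rw [mehler, gaussianPDF, gaussianPDF, ← ENNReal.ofReal_mul (mehlerReal_nonneg _ _ _),
      ← ENNReal.ofReal_mul (by positivity), mehlerReal_diag_mul_pdf hr]
  simp_rw [h]
  rw [lintegral_const_mul _ (measurable_gaussianPDF _ _),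
    lintegral_gaussianPDF_eq_one _ (by simpa using h4), mul_one]

/-! ### The density of a correlated Gaussian pair -/

/-- The bivariate normal law with correlation `ρ` is that of `(U, ρ U + √(1 - ρ²) V)` for
independent standard normal `U`, `V`; the two characteristic functions agree. -/
theorem multivariateGaussian_eq_map {ρ : ℝ} (hρ : |ρ| ≤ 1) :
    multivariateGaussian (0 : EuclideanSpace ℝ (Fin 2)) !![1, ρ; ρ, 1] =
      ((gaussianReal 0 1).prod (gaussianReal 0 1)).map
        fun p => (!₂[p.1, ρ * p.1 + √(1 - ρ ^ 2) * p.2] : EuclideanSpace ℝ (Fin 2)) := by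
  have h1 : ρ ^ 2 ≤ 1 := (sq_le_one_iff_abs_le_one ρ).2 hρ
  have hS : (!![1, ρ; ρ, 1] : Matrix (Fin 2) (Fin 2) ℝ).PosSemidef := by
    refine Matrix.PosSemidef.of_dotProduct_mulVec_nonneg ?_ fun x => ?_
    · ext i j; fin_cases i <;> fin_cases j <;> simp
    · simp [Matrix.mulVec, dotProduct, Fin.sum_univ_two]
      nlinarith [sq_nonneg (x 0 + ρ * x 1), sq_nonneg (x 1),
        mul_nonneg (sub_nonneg.2 h1) (sq_nonneg (x 1))]
  have hm : Measurable fun p : ℝ × ℝ =>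
      (!₂[p.1, ρ * p.1 + √(1 - ρ ^ 2) * p.2] : EuclideanSpace ℝ (Fin 2)) := by
    refine (WithLp.measurable_toLp 2 _).comp (measurable_pi_lambda _ fun i => ?_)
    fin_cases i <;> simp <;> fun_prop
  have : IsProbabilityMeasure (((gaussianReal 0 1).prod (gaussianReal 0 1)).map
        fun p => (!₂[p.1, ρ * p.1 + √(1 - ρ ^ 2) * p.2] : EuclideanSpace ℝ (Fin 2))) :=
    Measure.isProbabilityMeasure_map hm.aemeasurable
  refine Measure.ext_of_charFun (funext fun t => ?_)
  rw [charFun_multivariateGaussian hS, charFun_apply, integral_map hm.aemeasurable (by fun_prop)]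
  have h : ∀ p : ℝ × ℝ, Complex.exp ((inner ℝ (!₂[p.1, ρ * p.1 + √(1 - ρ ^ 2) * p.2] :
      EuclideanSpace ℝ (Fin 2)) t : ℝ) * Complex.I) =
      Complex.exp ((t 0 + ρ * t 1 : ℝ) * p.1 * Complex.I) *
        Complex.exp ((√(1 - ρ ^ 2) * t 1 : ℝ) * p.2 * Complex.I) := by
    intro p
    rw [← Complex.exp_add]
    congr 1
    simp [PiLp.inner_apply, Fin.sum_univ_two]
    ring
  simp_rw [h]
  rw [integral_prod_mul (fun x : ℝ => Complex.exp ((t 0 + ρ * t 1 : ℝ) * x * Complex.I))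
    (fun x : ℝ => Complex.exp ((√(1 - ρ ^ 2) * t 1 : ℝ) * x * Complex.I)),
    ← charFun_apply_real, ← charFun_apply_real, charFun_gaussianReal, charFun_gaussianReal,
    ← Complex.exp_add]
  congr 1
  have h2 : ((√(1 - ρ ^ 2) : ℝ) : ℂ) ^ 2 = 1 - ρ ^ 2 := by
    rw [← Complex.ofReal_pow, Real.sq_sqrt (by linarith)]
    push_cast; ring
  simp [Matrix.mulVec, dotProduct, Fin.sum_univ_two, mul_pow, h2]
  ring

theorem map_multivariateGaussian {ρ : ℝ} (hρ : |ρ| < 1) :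
    (multivariateGaussian (0 : EuclideanSpace ℝ (Fin 2)) !![1, ρ; ρ, 1]).map
        (fun z => (z 0, z 1)) =
      ((gaussianReal 0 1).prod (gaussianReal 0 1)).withDensity fun p => mehler ρ p.1 p.2 := by
  have h1 : ρ ^ 2 < 1 := (sq_lt_one_iff_abs_lt_one ρ).2 hρ
  have hm : Measurable fun p : ℝ × ℝ =>
      (!₂[p.1, ρ * p.1 + √(1 - ρ ^ 2) * p.2] : EuclideanSpace ℝ (Fin 2)) := by
    refine (WithLp.measurable_toLp 2 _).comp (measurable_pi_lambda _ fun i => ?_)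
    fin_cases i <;> simp <;> fun_prop
  rw [multivariateGaussian_eq_map hρ.le, Measure.map_map (by fun_prop) hm]
  ext s hs
  have hf : Measurable (s.indicator (1 : ℝ × ℝ → ℝ≥0∞)) := measurable_one.indicator hs
  rw [Measure.map_apply (by fun_prop) hs, withDensity_apply _ hs, ← lintegral_indicator hs,
    ← lintegral_indicator_one (by measurability), lintegral_prod _ (by measurability),
    lintegral_prod _ (by measurability)]
  refine lintegral_congr fun x => ?_
  have e1 : ∀ y, s.indicator (fun p : ℝ × ℝ => mehler ρ p.1 p.2) (x, y) =
      mehler ρ x y * s.indicator 1 (x, y) := by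
    intro y
    by_cases h : (x, y) ∈ s <;> simp [h]
  simp_rw [e1]
  have hg : Measurable fun y : ℝ => s.indicator (1 : ℝ × ℝ → ℝ≥0∞) (x, y) := by fun_prop
  rw [lintegral_mehler_mul hρ x hg]
  have e2 : gaussianReal (ρ * x) (1 - ρ ^ 2).toNNReal =
      (gaussianReal 0 1).map fun y => ρ * x + √(1 - ρ ^ 2) * y := by
    have := gaussianReal_map_const_mul (μ := 0) (v := 1) (√(1 - ρ ^ 2))
    have h3 := congrArg (fun m => Measure.map (fun y => ρ * x + y) m) this
    simp only [gaussianReal_map_const_add] at h3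
    rw [Measure.map_map (by fun_prop) (by fun_prop)] at h3
    rw [show (fun y => ρ * x + √(1 - ρ ^ 2) * y) =
      (fun y => ρ * x + y) ∘ (√(1 - ρ ^ 2) * ·) from rfl,
      h3]
    congr 1
    · ring
    · ext
      simp [Real.sq_sqrt (sub_nonneg.2 h1.le), h1.le]
  rw [e2, lintegral_map hg (by fun_prop)]
  rfl

/-! ### Cyclic products of kernels along a permutation -/

/-- `t` to the number of cycles of `σ`, defined by removing the point `0` from its cycle: a factor
`t` is collected exactly when `0` is a fixed point of the current permutation. -/
noncomputable def cycleBound (t : ℝ≥0∞) : (n : ℕ) → Equiv.Perm (Fin n) → ℝ≥0∞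
  | 0, _ => 1
  | n + 1, σ =>
    (if σ 0 = 0 then t else 1) * cycleBound t n (Equiv.Perm.decomposeFin σ).2

/-- The generating function of permutations by number of cycles is a rising factorial. -/
theorem sum_cycleBound (t : ℝ≥0∞) (n : ℕ) :
    ∑ σ, cycleBound t n σ = ∏ j ∈ Finset.range n, (t + j) := by
  induction n with
  | zero => simp [cycleBound]
  | succ n ih =>
    rw [← Equiv.sum_comp Equiv.Perm.decomposeFin.symm, Fintype.sum_prod_type,
      Finset.prod_range_succ, ← ih, Fin.sum_univ_succ]
    simp [cycleBound, ← Finset.mul_sum]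
    ring

/-- For kernels `K r` that compose by multiplication of the parameter and have traces at most `t`,
the integral of the product of the kernels along the edges `i → σ i` is at most `t` to the number
of cycles of `σ`. The parameter is allowed to depend on the edge because integrating out a vertex
multiplies the parameters of its two edges. -/
theorem lintegral_prod_kernel_le {Y : Type*} [MeasurableSpace Y] (γ : Measure Y)
    [IsProbabilityMeasure γ] {K : ℝ → Y → Y → ℝ≥0∞} (hK : ∀ r, Measurable (Function.uncurry (K r)))
    {I : Set ℝ} (hI : ∀ r ∈ I, ∀ s ∈ I, r * s ∈ I)
    (hmul : ∀ r ∈ I, ∀ s ∈ I, ∀ x z, ∫⁻ y, K r x y * K s y z ∂γ = K (r * s) x z)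
    {t : ℝ≥0∞} (hdiag : ∀ r ∈ I, ∫⁻ y, K r y y ∂γ ≤ t) {n : ℕ} (σ : Equiv.Perm (Fin n))
    (w : Fin n → ℝ) (hw : ∀ i, w i ∈ I) :
    ∫⁻ y, ∏ i, K (w i) (y i) (y (σ i)) ∂(Measure.pi fun _ => γ) ≤ cycleBound t n σ := by
  have hK' : ∀ (m : ℕ) (r : ℝ) (i j : Fin m), Measurable fun y : Fin m → Y => K r (y i) (y j) :=
    fun m r i j => (hK r).comp (f := fun y : Fin m → Y => (y i, y j))
      ((measurable_pi_apply i).prodMk (measurable_pi_apply j))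
  induction n with
  | zero => simp [cycleBound]
  | succ n ih =>
    obtain ⟨⟨p, e⟩, rfl⟩ := Equiv.Perm.decomposeFin.symm.surjective σ
    rw [lintegral_pi_succ γ (Finset.measurable_prod _ fun i _ => hK' _ _ _ _)]
    simp only [Fin.prod_univ_succ, Fin.cons_zero, Fin.cons_succ,
      Equiv.Perm.decomposeFin_symm_apply_zero, Equiv.Perm.decomposeFin_symm_apply_succ, cycleBound,
      Equiv.apply_symm_apply]
    have hKd : ∀ r, Measurable fun a => K r a a := fun r =>
      (hK r).comp (measurable_id.prodMk measurable_id)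
    cases p using Fin.cases with
    | zero =>
      simp only [Equiv.swap_self, Equiv.refl_apply, Fin.cons_succ, Fin.cons_zero, if_true]
      simp_rw [lintegral_mul_const _ (hKd _)]
      rw [lintegral_const_mul _ (Finset.measurable_prod _ fun i _ => hK' _ _ _ _)]
      exact mul_le_mul' (hdiag _ (hw 0)) (ih e _ fun i => hw _)
    | succ a =>
      set b := e.symm a with hb
      have hLR : ∀ r s x z, Measurable fun c => K r x c * K s c z := fun r s x z =>
        ((hK r).comp (f := fun c => (x, c)) (measurable_const.prodMk measurable_id)).mul
          ((hK s).comp (f := fun c => (c, z)) (measurable_id.prodMk measurable_const))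
      rw [if_neg (Fin.succ_ne_zero a), one_mul]
      -- The edges `b → 0` and `0 → a` merge into one edge `b → a = e b`.
      refine le_trans (le_of_eq ?_) (ih e
        (Function.update (fun i => w i.succ) b (w b.succ * w 0)) fun i => ?_)
      · refine lintegral_congr fun y => ?_
        have h : ∀ c, (∏ i : Fin n, K (w i.succ) (y i)
            ((Fin.cons c y : Fin (n + 1) → Y) (Equiv.swap 0 a.succ (e i).succ))) =
            K (w b.succ) (y b) c *
              ∏ i ∈ Finset.univ.erase b, K (w i.succ) (y i) (y (e i)) := by
          intro c
          rw [← Finset.mul_prod_erase _ _ (Finset.mem_univ b)]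
          congr 1
          · simp [hb]
          · refine Finset.prod_congr rfl fun i hi => ?_
            have hne : e i ≠ a := fun h => (Finset.ne_of_mem_erase hi) (by simp [hb, ← h])
            rw [Equiv.swap_apply_of_ne_of_ne (Fin.succ_ne_zero _)
              (fun h => hne (Fin.succ_injective _ h)), Fin.cons_succ]
        simp_rw [h, Fin.cons_succ]
        have h' : ∀ c, K (w 0) c (y a) * (K (w b.succ) (y b) c *
              ∏ i ∈ Finset.univ.erase b, K (w i.succ) (y i) (y (e i))) =
            K (w b.succ) (y b) c * K (w 0) c (y a) *
              ∏ i ∈ Finset.univ.erase b, K (w i.succ) (y i) (y (e i)) := fun c => by ring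
        simp_rw [h']
        rw [lintegral_mul_const _ (hLR _ _ _ _), hmul _ (hw _) _ (hw _),
          ← Finset.mul_prod_erase Finset.univ _ (Finset.mem_univ b)]
        congr 1
        · simp [hb]
        · refine Finset.prod_congr rfl fun i hi => ?_
          rw [Function.update_of_ne (Finset.ne_of_mem_erase hi)]
      · by_cases h : i = b
        · subst h
          simpa using hI _ (hw _) _ (hw _)
        · simpa [Function.update_of_ne h] using hw _

/-! ### Likelihood ratios of the vector and database models -/

/-- The Mehler kernel on `ℝᵈ`: the density of `correlatedPair d r` with respect to the product of
two standard normal laws on `ℝᵈ`, for `|r| < 1`. -/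
noncomputable def vectorMehler (d : ℕ) (r : ℝ) (x y : Fin d → ℝ) : ℝ≥0∞ :=
  ∏ j, mehler r (x j) (y j)

@[fun_prop]
theorem measurable_vectorMehler {α : Type*} [MeasurableSpace α] {d : ℕ} (r : ℝ)
    {f g : α → Fin d → ℝ} (hf : Measurable f) (hg : Measurable g) :
    Measurable fun a => vectorMehler d r (f a) (g a) := by
  unfold vectorMehler
  fun_prop

theorem vectorMehler_comm {d : ℕ} (r : ℝ) (x y : Fin d → ℝ) :
    vectorMehler d r x y = vectorMehler d r y x :=
  Finset.prod_congr rfl fun _ _ => mehler_comm _ _ _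

instance (d : ℕ) : IsProbabilityMeasure (stdNormal d) := by
  unfold stdNormal; infer_instance

theorem lintegral_vectorMehler_mul {d : ℕ} {r s : ℝ} (hr : |r| < 1) (hs : |s| < 1)
    (x z : Fin d → ℝ) :
    ∫⁻ y, vectorMehler d r x y * vectorMehler d s y z ∂(stdNormal d) =
      vectorMehler d (r * s) x z := by
  unfold vectorMehler stdNormal
  simp_rw [← Finset.prod_mul_distrib]
  rw [lintegral_pi_prod (f := fun j a => mehler r (x j) a * mehler s a (z j)) _
    fun j => by fun_prop]
  exact Finset.prod_congr rfl fun j _ => lintegral_mehler_mul_mehler hr hs _ _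

theorem lintegral_vectorMehler_diag {d : ℕ} {r : ℝ} (hr : |r| < 1) :
    ∫⁻ y, vectorMehler d r y y ∂(stdNormal d) = ENNReal.ofReal (1 - r)⁻¹ ^ d := by
  unfold vectorMehler stdNormal
  rw [lintegral_pi_prod (f := fun _ a => mehler r a a) _ fun j => by fun_prop]
  simp [lintegral_mehler_diag hr]

instance (d : ℕ) (ρ : ℝ) : IsProbabilityMeasure (correlatedPair d ρ) := by
  unfold correlatedPair
  exact Measure.isProbabilityMeasure_map (by fun_prop)

instance (n d : ℕ) (ρ : ℝ) (σ : Equiv.Perm (Fin n)) : IsProbabilityMeasure (altLaw n d ρ σ) := by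
  unfold altLaw
  exact Measure.isProbabilityMeasure_map (by fun_prop)

instance (n d : ℕ) : IsProbabilityMeasure (nullLaw n d) := by
  unfold nullLaw; infer_instance

theorem correlatedPair_eq_withDensity (d : ℕ) {ρ : ℝ} (hρ : |ρ| < 1) :
    correlatedPair d ρ = ((stdNormal d).prod (stdNormal d)).withDensity
      fun p => vectorMehler d ρ p.1 p.2 := by
  have hk := map_multivariateGaussian hρ
  have hm : Measurable fun z : EuclideanSpace ℝ (Fin 2) => (z 0, z 1) := by fun_prop
  have : IsProbabilityMeasure (((gaussianReal 0 1).prod (gaussianReal 0 1)).withDensity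
      fun p => mehler ρ p.1 p.2) := by
    rw [← hk]
    exact Measure.isProbabilityMeasure_map hm.aemeasurable
  have h := map_pi_prod_withDensity (gaussianReal 0 1) (gaussianReal 0 1) (n := d)
    (k := fun p => mehler ρ p.1 p.2) (by fun_prop)
  have : IsProbabilityMeasure ((multivariateGaussian (0 : EuclideanSpace ℝ (Fin 2))
      !![1, ρ; ρ, 1]).map (fun z => (z 0, z 1))) := by
    rw [hk]; infer_instance
  rw [← hk, ← Measure.pi_map_pi fun _ => hm.aemeasurable,
    Measure.map_map (by fun_prop) (by fun_prop)] at h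
  exact h

/-- The density of `altLaw n d ρ σ` with respect to `nullLaw n d`, for `|ρ| < 1`. -/
noncomputable def likelihoodRatio (n d : ℕ) (ρ : ℝ) (σ : Equiv.Perm (Fin n))
    (p : Database n d × Database n d) : ℝ≥0∞ :=
  ∏ i, vectorMehler d ρ (p.1 i) (p.2 (σ i))

theorem measurable_likelihoodRatio (n d : ℕ) (ρ : ℝ) (σ : Equiv.Perm (Fin n)) :
    Measurable (likelihoodRatio n d ρ σ) := by
  unfold likelihoodRatio
  fun_prop

theorem altLaw_eq_withDensity (n d : ℕ) {ρ : ℝ} (hρ : |ρ| < 1) (σ : Equiv.Perm (Fin n)) :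
    altLaw n d ρ σ = (nullLaw n d).withDensity (likelihoodRatio n d ρ σ) := by
  have hk := correlatedPair_eq_withDensity d hρ
  have : IsProbabilityMeasure (((stdNormal d).prod (stdNormal d)).withDensity
      fun p => vectorMehler d ρ p.1 p.2) := by
    rw [← hk]; infer_instance
  have h := map_pi_prod_withDensity (stdNormal d) (stdNormal d) (n := n)
    (k := fun p => vectorMehler d ρ p.1 p.2) (by fun_prop)
  have hm : MeasurePreserving
      (fun p : Database n d × Database n d => (p.1, fun j => p.2 (σ.symm j)))
      (nullLaw n d) (nullLaw n d) := by
    have h := measurePreserving_piCongrLeft (fun _ : Fin n => stdNormal d) σ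
    have e : ⇑(MeasurableEquiv.piCongrLeft (fun _ : Fin n => Fin d → ℝ) σ) =
        fun y j => y (σ.symm j) := by
      funext y j
      obtain ⟨i, rfl⟩ := σ.surjective j
      rw [MeasurableEquiv.piCongrLeft_apply_apply, σ.symm_apply_apply]
    rw [e] at h
    exact (MeasurePreserving.id _).prod h
  rw [← hk] at h
  have e : altLaw n d ρ σ = ((Measure.pi fun _ : Fin n => correlatedPair d ρ).map
      (fun w => (fun i => (w i).1, fun i => (w i).2))).map
        (fun p : Database n d × Database n d => (p.1, fun j => p.2 (σ.symm j))) := by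
    rw [Measure.map_map hm.measurable (by fun_prop)]
    rfl
  rw [e, h]
  have h2 : (fun p : Database n d × Database n d => ∏ i, vectorMehler d ρ (p.1 i) (p.2 i)) =
      likelihoodRatio n d ρ σ ∘ (fun p => (p.1, fun j => p.2 (σ.symm j))) := by
    ext p
    simp [likelihoodRatio]
  rw [h2, map_withDensity_comp hm.measurable (measurable_likelihoodRatio n d ρ σ)]
  exact congrArg (fun m => Measure.withDensity m _) hm.map_eq

/-- After integrating out the first database, only the permutation `τ * σ⁻¹` and the correlation
`ρ ^ 2` matter. -/
theorem lintegral_likelihoodRatio_mul_le (n d : ℕ) {ρ : ℝ} (hρ : |ρ| < 1)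
    (σ τ : Equiv.Perm (Fin n)) :
    ∫⁻ p, likelihoodRatio n d ρ σ p * likelihoodRatio n d ρ τ p ∂(nullLaw n d) ≤
      cycleBound (ENNReal.ofReal (1 - ρ ^ 2)⁻¹ ^ d) n (τ * σ⁻¹) := by
  have h1 : ρ ^ 2 < 1 := (sq_lt_one_iff_abs_lt_one ρ).2 hρ
  have e : ∫⁻ p, likelihoodRatio n d ρ σ p * likelihoodRatio n d ρ τ p ∂(nullLaw n d) =
      ∫⁻ y, ∏ i, vectorMehler d (ρ ^ 2) (y i) (y ((τ * σ⁻¹) i))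
        ∂(Measure.pi fun _ : Fin n => stdNormal d) := by
    rw [nullLaw, lintegral_prod_symm (fun p => likelihoodRatio n d ρ σ p *
      likelihoodRatio n d ρ τ p) ((measurable_likelihoodRatio n d ρ σ).mul
      (measurable_likelihoodRatio n d ρ τ)).aemeasurable]
    refine lintegral_congr fun y => ?_
    simp only [likelihoodRatio, ← Finset.prod_mul_distrib]
    rw [lintegral_pi_prod (f := fun i x => vectorMehler d ρ x (y (σ i)) *
      vectorMehler d ρ x (y (τ i))) _ fun i => by fun_prop,
      ← Equiv.prod_comp σ fun i => vectorMehler d (ρ ^ 2) (y i) (y ((τ * σ⁻¹) i))]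
    refine Finset.prod_congr rfl fun i _ => ?_
    trans ∫⁻ x, vectorMehler d ρ (y (σ i)) x * vectorMehler d ρ x (y (τ i)) ∂(stdNormal d)
    · exact lintegral_congr fun x => by rw [vectorMehler_comm ρ x (y (σ i))]
    · rw [lintegral_vectorMehler_mul hρ hρ, ← sq]
      simp
  rw [e]
  refine lintegral_prod_kernel_le (stdNormal d) (K := vectorMehler d) (I := Set.Icc 0 (ρ ^ 2))
    (fun r => by unfold Function.uncurry; fun_prop) (fun r hr s hs => ?_) (fun r hr s hs x z => ?_)
    (fun r hr => ?_) (τ * σ⁻¹) (fun _ => ρ ^ 2) fun _ => ⟨sq_nonneg _, le_rfl⟩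
  · exact ⟨mul_nonneg hr.1 hs.1, by nlinarith [hr.1, hr.2, hs.1, hs.2]⟩
  · exact lintegral_vectorMehler_mul (by rw [abs_of_nonneg hr.1]; linarith [hr.2])
      (by rw [abs_of_nonneg hs.1]; linarith [hs.2]) x z
  · rw [lintegral_vectorMehler_diag (by rw [abs_of_nonneg hr.1]; linarith [hr.2])]
    gcongr
    exact hr.2

theorem sum_lintegral_likelihoodRatio_mul_le (n d : ℕ) {ρ : ℝ} (hρ : |ρ| < 1) :
    ∑ σ, ∑ τ, ∫⁻ p, likelihoodRatio n d ρ σ p * likelihoodRatio n d ρ τ p ∂(nullLaw n d) ≤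
      n.factorial * ∏ j ∈ Finset.range n, (ENNReal.ofReal (1 - ρ ^ 2)⁻¹ ^ d + j) := by
  calc _ ≤ ∑ σ : Equiv.Perm (Fin n), ∑ τ : Equiv.Perm (Fin n),
        cycleBound (ENNReal.ofReal (1 - ρ ^ 2)⁻¹ ^ d) n (τ * σ⁻¹) :=
        Finset.sum_le_sum fun σ _ => Finset.sum_le_sum fun τ _ =>
          lintegral_likelihoodRatio_mul_le n d hρ σ τ
    _ = ∑ σ : Equiv.Perm (Fin n), ∑ π, cycleBound (ENNReal.ofReal (1 - ρ ^ 2)⁻¹ ^ d) n π :=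
        Finset.sum_congr rfl fun σ _ => Equiv.sum_comp (Equiv.mulRight σ⁻¹) _
    _ = _ := by simp [sum_cycleBound, Fintype.card_perm]

/-! ### Bounds for the minimax risk -/

/-- The rising factorial of `1 + η`, divided by `n !`, is `∏ (1 + η / j) ≤ exp (η Hₙ)`. -/
theorem prod_range_add_le {η : ℝ} (hη : 0 ≤ η) (n : ℕ) :
    ∏ j ∈ Finset.range n, (1 + η + j) ≤ n.factorial * Real.exp (η * (harmonic n : ℝ)) := by
  induction n with
  | zero => simp
  | succ n ih =>
    have h : 1 + η + n ≤ (n + 1) * Real.exp (η * ((n : ℝ) + 1)⁻¹) := by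
      have h1 := Real.add_one_le_exp (η * ((n : ℝ) + 1)⁻¹)
      calc 1 + η + n = (n + 1) * (η * ((n : ℝ) + 1)⁻¹ + 1) := by field_simp; ring
        _ ≤ _ := by gcongr
    rw [Finset.prod_range_succ, harmonic_succ, Nat.factorial_succ]
    rw [Rat.cast_add, mul_add η, Real.exp_add]
    push_cast
    calc _ ≤ n.factorial * Real.exp (η * (harmonic n : ℝ)) *
          ((n + 1) * Real.exp (η * ((n : ℝ) + 1)⁻¹)) := by gcongr
      _ = _ := by ring

theorem inv_one_sub_pow_le {d : ℕ} {x : ℝ} (hx : 0 ≤ x) (hx1 : x < 1) (h : d * x ≤ 1 / 2) :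
    (1 - x)⁻¹ ^ d ≤ 1 + 2 * (d * x) := by
  have h1 : 1 - d * x ≤ (1 - x) ^ d := by
    have := one_add_mul_le_pow (show -2 ≤ -x by linarith) d
    rw [← sub_eq_add_neg] at this
    linarith
  have h0 : 0 ≤ d * x := by positivity
  rw [inv_pow, inv_le_comm₀ (by have := sub_pos.2 hx1; positivity) (by positivity)]
  refine le_trans ?_ h1
  rw [inv_le_iff_one_le_mul₀ (by positivity)]
  nlinarith

theorem harmonic_le_two_mul_sqrt {n : ℕ} (hn : 1 ≤ n) : (harmonic n : ℝ) ≤ 2 * √n := by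
  have hn' : (1 : ℝ) ≤ n := by exact_mod_cast hn
  have h := Real.log_le_sub_one_of_pos (Real.sqrt_pos.2 (by linarith : (0 : ℝ) < n))
  rw [Real.log_sqrt (by linarith)] at h
  linarith [harmonic_le_one_add_log n]

theorem setOf_eq_zero_eq_compl_and_measurableSet {n d : ℕ} {φ : Database n d × Database n d → Fin 2}
    (hφ : Measurable φ) : {p | φ p = 0} = {p | φ p = 1}ᶜ ∧ MeasurableSet {p | φ p = 1} := by
  refine ⟨?_, hφ (measurableSet_singleton 1)⟩
  ext p
  simp only [Set.mem_ofPred_eq, Set.mem_compl_iff]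
  lia

theorem le_minimaxRisk {n d : ℕ} {ρ : ℝ} (hn : 1 ≤ n) (hρ : |ρ| < 1) (hd : d * ρ ^ 2 ≤ 1 / 2)
    {a : ℝ} (ha : 0 < a) :
    1 - (a ^ 2 + Real.exp (4 * (ρ ^ 2 * (d * √n))) - 1) / (2 * a) ≤ minimaxRisk n d ρ := by
  have h1 : ρ ^ 2 < 1 := (sq_lt_one_iff_abs_lt_one ρ).2 hρ
  have hinv : 0 < (1 - ρ ^ 2)⁻¹ := inv_pos.2 (sub_pos.2 h1)
  have : Nonempty {φ : Database n d × Database n d → Fin 2 // Measurable φ} :=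
    ⟨⟨fun _ => 0, measurable_const⟩⟩
  refine le_ciInf fun ⟨φ, hφ⟩ => ?_
  obtain ⟨h0, hm⟩ := setOf_eq_zero_eq_compl_and_measurableSet hφ
  simp only [risk]
  rw [h0]
  refine one_sub_le_add_iSup (measurable_likelihoodRatio n d ρ)
    (fun σ => altLaw_eq_withDensity n d hρ σ) (Real.exp_pos _).le ?_ ha hm
  refine (sum_lintegral_likelihoodRatio_mul_le n d hρ).trans ?_
  have e : (n.factorial : ℝ≥0∞) * ∏ j ∈ Finset.range n, (ENNReal.ofReal (1 - ρ ^ 2)⁻¹ ^ d + j) =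
      ENNReal.ofReal (n.factorial * ∏ j ∈ Finset.range n, ((1 - ρ ^ 2)⁻¹ ^ d + (j : ℝ))) := by
    rw [ENNReal.ofReal_mul (by positivity), ENNReal.ofReal_natCast,
      ENNReal.ofReal_prod_of_nonneg fun j _ => by positivity]
    congr 1
    refine Finset.prod_congr rfl fun j _ => ?_
    rw [ENNReal.ofReal_add (by positivity) (by positivity), ENNReal.ofReal_pow hinv.le,
      ENNReal.ofReal_natCast]
  rw [e, Fintype.card_perm, Fintype.card_fin]
  refine ENNReal.ofReal_le_ofReal ?_
  rw [sq (n.factorial : ℝ), mul_assoc]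
  gcongr
  calc ∏ j ∈ Finset.range n, ((1 - ρ ^ 2)⁻¹ ^ d + (j : ℝ))
      ≤ ∏ j ∈ Finset.range n, (1 + 2 * (d * ρ ^ 2) + (j : ℝ)) :=
        Finset.prod_le_prod (fun j _ => by positivity) fun j _ =>
          add_le_add_left (inv_one_sub_pow_le (sq_nonneg _) h1 hd) _
    _ ≤ n.factorial * Real.exp (2 * (d * ρ ^ 2) * (harmonic n : ℝ)) :=
        prod_range_add_le (by positivity) n
    _ ≤ n.factorial * Real.exp (2 * (d * ρ ^ 2) * (2 * √n)) := by
        gcongr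
        exact harmonic_le_two_mul_sqrt hn
    _ = _ := by ring_nf

theorem minimaxRisk_le_one (n d : ℕ) (ρ : ℝ) : minimaxRisk n d ρ ≤ 1 := by
  have hb : BddBelow (Set.range fun φ : {φ : Database n d × Database n d → Fin 2 // Measurable φ} =>
      risk n d ρ φ.1) := by
    refine ⟨0, ?_⟩
    rintro _ ⟨φ, rfl⟩
    exact add_nonneg measureReal_nonneg (Real.iSup_nonneg fun σ => measureReal_nonneg)
  refine (ciInf_le hb ⟨fun _ => 1, measurable_const⟩).trans ?_
  simp [risk]

end DatabaseAlignment

theorem theorem2 {ι : Type*} (l : Filter ι) (n d : ι → ℕ) (ρ : ι → ℝ)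
    (hn : ∀ i, Real.exp 1 ^ 2 ≤ (n i : ℝ))
    (hρ : ∀ i, ρ i ≠ 0) (hρ1 : ∀ i, |ρ i| ≤ 1)
    (hn_top : Tendsto n l atTop) (hd_top : Tendsto d l atTop)
    (hsmall : (fun i => ρ i ^ 2) =o[l] fun i => 1 / ((d i : ℝ) * √(n i : ℝ)))
    (hlog : (fun i => Real.log (n i : ℝ)) =O[l] fun i => (d i : ℝ)) :
    Tendsto (fun i => DatabaseAlignment.minimaxRisk (n i) (d i) (ρ i)) l (nhds 1) := by
  have hn1 : ∀ᶠ i in l, 1 ≤ n i := hn_top.eventually_ge_atTop 1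
  have hd1 : ∀ᶠ i in l, 1 ≤ d i := hd_top.eventually_ge_atTop 1
  have hu : Tendsto (fun i => ρ i ^ 2 * (d i * √(n i : ℝ))) l (nhds 0) := by
    simpa only [one_div, div_inv_eq_mul] using hsmall.tendsto_div_nhds_zero
  have hexp : Tendsto (fun i => Real.exp (4 * (ρ i ^ 2 * (d i * √(n i : ℝ))))) l (nhds 1) := by
    simpa using (hu.const_mul 4).rexp
  have hgood : ∀ᶠ i in l, 1 ≤ n i ∧ |ρ i| < 1 ∧ d i * ρ i ^ 2 ≤ 1 / 2 := by
    filter_upwards [hn1, hd1, hu.eventually_le_const (show (0 : ℝ) < 1 / 2 by norm_num)]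
      with i hi hdi hui
    have h1 : 1 ≤ √(n i : ℝ) := Real.one_le_sqrt.2 (by exact_mod_cast hi)
    have h2 : (1 : ℝ) ≤ d i := by exact_mod_cast hdi
    have h3 : d i * ρ i ^ 2 ≤ 1 / 2 := by
      refine le_trans ?_ hui
      nlinarith [mul_le_mul_of_nonneg_left h1 (show 0 ≤ d i * ρ i ^ 2 by positivity)]
    refine ⟨hi, (sq_lt_one_iff_abs_lt_one _).1 ?_, h3⟩
    nlinarith [mul_le_mul_of_nonneg_right h2 (sq_nonneg (ρ i))]
  refine tendsto_order.2 ⟨fun b hb => ?_, fun b hb => Eventually.of_forall fun i =>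
    (DatabaseAlignment.minimaxRisk_le_one _ _ _).trans_lt hb⟩
  set a := 1 - b with ha
  have ha0 : 0 < a := by linarith
  filter_upwards [hgood, hexp.eventually_lt_const (show (1 : ℝ) < 1 + a ^ 2 by nlinarith)]
    with i ⟨h1, h2, h3⟩ h4
  refine lt_of_lt_of_le ?_ (DatabaseAlignment.le_minimaxRisk h1 h2 h3 ha0)
  have h5 : (a ^ 2 + Real.exp (4 * (ρ i ^ 2 * (d i * √(n i : ℝ)))) - 1) / (2 * a) < a := by
    rw [div_lt_iff₀ (by positivity)]
    nlinarith
  linarith
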